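/- Let $d\ge 3$ and $n\ge 2$ be integers. Let $T_n$ be the finite rooted tree in which every non-leaf vertex has $d-1$ children and the path from each leaf to the root $r$ has $n-1$ edges. The wired regular tree $\bar T_n$ is the multigraph obtained from $T_n$ by collapsing all leaves to a single vertex $s$, the sink (without collapsing edges), and adding one edge joining the root to the sink; $\bar T_1$ is understood to have the sink as its only vertex, which is then also the root. For a finite multigraph $G$ with a chosen sink and $m$ further vertices $x_1,\dots,x_m$, let $\Delta$ be the reduced Laplacian, the $m\times m$ integer matrix with $\Delta_{ii}=-\deg(x_i)$ and, for $i\ne j$, $\Delta_{ij}$ the number of edges joining $x_i$ and $x_j$. The sandpile group of $G$ is $SP(G)=\mathbb Z^m/\Delta\mathbb Z^m$. Let $\hat r\in SP(\bar T_n)$ be the class of the configuration with a single chip at the root $r$ (so $\hat r=0$ if $n=1$), and let $R(\bar T_n)=\langle\hat r\rangle$ be the subgroup it generates. Then $R(\bar T_n)$ is a direct summand of $SP(\bar T_n)$, that is, there is a subgroup $C$ with $SP(\bar T_n)=R(\bar T_n)\oplus C$. Moreover $$SP(\bar T_n)\;\cong\; R(\bar T_n)\;\oplus\;\frac{SP(\bar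 T_{n-1})^{\oplus(d-1)}}{\{(x,\dots,x)\,:\,x\in R(\bar T_{n-1})\}}.$$ -/

import Mathlib

open scoped Graph

namespace Sandpile

section General

variable {α β : Type*}

/-- The number of edges of the multigraph `G` joining `x` and `y`. -/
noncomputable def edgeCount (G : Graph α β) (x y : α) : ℕ :=
  {e | G.IsLink e x y}.ncard

/-- The degree of `x`: the number of edges with `x` as an end. (The sandpile group is considered
for multigraphs without loops; a loop, if there is one, is disregarded.) -/
noncomputable def vertexDegree (G : Graph α β) (x : α) : ℕ :=
  {e | G.IsNonloopAt e x}.ncard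

/-- The vertices of `G` other than the sink `s`. -/
abbrev NonSink (G : Graph α β) (s : α) : Type _ := {x : α // x ∈ V(G) ∧ x ≠ s}

open Classical in
/-- The reduced Laplacian of `G` with sink `s`: minus the degree on the diagonal and the number
of connecting edges off the diagonal. -/
noncomputable def reducedLaplacian (G : Graph α β) (s : α) :
    Matrix (NonSink G s) (NonSink G s) ℤ :=
  Matrix.of fun x y => if x = y then -(vertexDegree G x.1 : ℤ) else (edgeCount G x.1 y.1 : ℤ)

/-- The image `Δ ℤ^m` of the reduced Laplacian of a finite multigraph, that is, the integer span
of its columns. -/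
noncomputable def laplacianLattice (G : Graph α β) (s : α) : Submodule ℤ (NonSink G s → ℤ) :=
  Submodule.span ℤ (Set.range (reducedLaplacian G s).col)

/-- The sandpile group `ℤ^m / Δ ℤ^m` of the finite multigraph `G` with sink `s`, where `m` is the
number of vertices other than the sink. -/
abbrev SandpileGroup (G : Graph α β) (s : α) : Type _ :=
  (NonSink G s → ℤ) ⧸ laplacianLattice G s

open Classical in
/-- The chip configuration with a single chip at the vertex `x`
(a chip at the sink is discarded). -/
noncomputable def singleChip (G : Graph α β) (s x : α) : NonSink G s → ℤ :=
  fun y => if y.1 = x then 1 else 0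

/-- The element of the sandpile group represented by a single chip at `x`. -/
noncomputable def chipClass (G : Graph α β) (s x : α) : SandpileGroup G s :=
  Submodule.Quotient.mk (singleChip G s x)

end General

/-- The `d`-regular tree of height `n`, rooted at the empty word. Its vertices are the words of
length at most `n - 1` in `d - 1` letters, and the children of `w` are the words `i :: w`. The edge
joining `i :: w` to its parent `w` is labelled by `i :: w`. -/
def regularTree (d n : ℕ) : Graph (List (Fin (d - 1))) (List (Fin (d - 1))) where
  vertexSet := {w | w.length < n}
  IsLink e x y := ∃ i w, e = i :: w ∧ (i :: w).length < n ∧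
    ((x = w ∧ y = i :: w) ∨ (x = i :: w ∧ y = w))
  isLink_symm := by
    rintro e -
    exact ⟨by rintro x y ⟨i, w, he, hl, h⟩; exact ⟨i, w, he, hl, by tauto⟩⟩
  eq_or_eq_of_isLink_of_isLink := by
    rintro e x y v u ⟨i, w, rfl, -, h⟩ ⟨j, w', he, -, h'⟩
    obtain ⟨rfl, rfl⟩ := List.cons.inj he
    rcases h with ⟨rfl, rfl⟩ | ⟨rfl, rfl⟩ <;> rcases h' with ⟨rfl, rfl⟩ | ⟨rfl, rfl⟩ <;> simp
  left_mem_of_isLink := by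
    rintro e x y ⟨i, w, -, hl, ⟨rfl, -⟩ | ⟨rfl, -⟩⟩
    · exact (Nat.lt_succ_self _).trans hl
    · exact hl

/-- The map that collapses the leaves of the regular tree of height `n` (the words of length
`n - 1`) to a single vertex `none`, the sink, and keeps all other vertices. -/
def collapse (d n : ℕ) (w : List (Fin (d - 1))) : Option (List (Fin (d - 1))) :=
  if w.length + 1 < n then some w else none

/-- The wired `d`-regular tree of height `n`: the leaves of the regular tree are collapsed to the
sink `none` (edges are not collapsed), and an edge labelled `none` from the root to the sink
is added. -/
def wiredTree (d n : ℕ) : Graph (Option (List (Fin (d - 1)))) (Option (List (Fin (d - 1)))) where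
  vertexSet := V((regularTree d n).map (collapse d n)) ∪ {collapse d n [], none}
  IsLink e x y := (∃ f, e = some f ∧ ((regularTree d n).map (collapse d n)).IsLink f x y) ∨
    (e = none ∧ s(x, y) = s(collapse d n [], none))
  isLink_symm := by
    rintro e -
    refine ⟨?_⟩
    rintro x y (⟨f, he, h⟩ | ⟨he, h⟩)
    · exact Or.inl ⟨f, he, h.symm⟩
    · exact Or.inr ⟨he, by rw [Sym2.eq_swap, h]⟩
  eq_or_eq_of_isLink_of_isLink := by
    rintro e x y v w (⟨f, rfl, h⟩ | ⟨rfl, h⟩) (⟨g, he, h'⟩ | ⟨he, h'⟩)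
    · obtain rfl := Option.some.inj he
      exact h.left_eq_or_eq h'
    · exact absurd he (by simp)
    · exact absurd he (by simp)
    · rw [← h', Sym2.eq_iff] at h
      tauto
  left_mem_of_isLink := by
    rintro e x y (⟨f, rfl, h⟩ | ⟨rfl, h⟩)
    · exact Or.inl h.left_mem
    · rw [Sym2.eq_iff] at h
      rcases h with ⟨rfl, -⟩ | ⟨rfl, -⟩ <;> simp

/-- The sandpile group of the wired `d`-regular tree of height `n`. For `n = 1` the tree has no
vertex besides the sink, and the group is trivial. -/
abbrev SP (d n : ℕ) : Type :=
  SandpileGroup (wiredTree d n) none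

/-- The element of `SP d n` represented by a single chip at the root. -/
noncomputable def rootElement (d n : ℕ) : SP d n :=
  chipClass (wiredTree d n) none (collapse d n [])

/-- The root subgroup: the subgroup of `SP d n` generated by the root. -/
noncomputable def rootSubgroup (d n : ℕ) : AddSubgroup (SP d n) :=
  AddSubgroup.zmultiples (rootElement d n)

/-- The diagonal copy of the root subgroup in the direct sum of `d - 1` copies of `SP d n`. -/
noncomputable def diagonalRootSubgroup (d n : ℕ) : AddSubgroup (Fin (d - 1) → SP d n) :=
  (rootSubgroup d n).map (AddMonoidHom.pi fun _ : Fin (d - 1) => AddMonoidHom.id (SP d n))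

end Sandpile

/-!
Write `a = d - 1` and `q = 1 + a + ⋯ + a ^ (n - 1)`. The sandpile group of the wired tree is the
abelian group generated by chips `chip d n w` at the vertices, subject to one relation per vertex
`w`: the chips at the children and at the parent of `w` add up to `d • chip d n w`, where chips at
the sink are zero. A homomorphism from the sandpile group to an abelian group is therefore the same
thing as a function on the vertices that is harmonic with value zero at the sink
(`IsHarmonic.exists_hom`, `SP_hom_ext`), and the rest of the argument uses only this universal
property.

*Direct summand.* Working upwards from the leaves, the relations give `q • rootElement = 0`
(`geom_sum_nsmul_rootElement`). In `ZMod q` the number `a` is invertible, because `a ^ n = 1`, and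
the function `w ↦ 1 + a⁻¹ + ⋯ + a ^ (-|w|)` of the level is harmonic: it vanishes at the leaves
exactly because the sum of all powers of `a⁻¹` is zero modulo `q`. It defines a homomorphism to
`ZMod q` that sends the root to `1` (`exists_hom_zmod`), and its kernel is a complement of the root
subgroup.

*The complement.* By the splitting, the complement is the quotient by the root subgroup. Killing
the chip at the root makes the root a sink for each of the `a` branches hanging from it, and each
branch becomes a wired tree of height `n - 1`, the edge to the old root playing the part of the
added edge. The remaining relation, at the root, says that the sum of the roots of the branches is
zero, and this generates the diagonal copy of the root subgroup
(`nonempty_quotient_rootSubgroup_addEquiv`).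
-/

namespace Sandpile

/-! ### The Laplacian of the wired tree -/

/-- The parent of the vertex `w` of the wired tree. The parent of the root is the sink `none`,
through the edge that wiring adds. -/
def parent {α : Type*} : List α → Option (List α)
  | [] => none
  | _ :: w => some w

/-- The label of the edge of the wired tree that joins `w` to its parent. -/
def parentEdge {α : Type*} : List α → Option (List α)
  | [] => none
  | i :: w => some (i :: w)

section Graph

variable {d n : ℕ}

lemma collapse_of_lt {w : List (Fin (d - 1))} (h : w.length + 1 < n) :
    collapse d n w = some w := if_pos h

lemma collapse_eq_some {w u : List (Fin (d - 1))} :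
    collapse d n w = some u ↔ w = u ∧ u.length + 1 < n := by
  unfold collapse
  split_ifs with h
  · constructor
    · intro e
      obtain rfl := Option.some.inj e
      exact ⟨rfl, h⟩
    · rintro ⟨rfl, -⟩
      rfl
  · constructor
    · intro e
      cases e
    · rintro ⟨rfl, h'⟩
      exact absurd h' h

lemma some_mem_wiredTree {w : List (Fin (d - 1))} :
    some w ∈ V(wiredTree d n) ↔ w.length + 1 < n := by
  change some w ∈ collapse d n '' {w | w.length < n} ∪ {collapse d n [], none} ↔ _
  constructor
  · rintro (⟨u, -, h⟩ | h | h)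
    · exact (collapse_eq_some.1 h).2
    · exact (collapse_eq_some.1 (Eq.symm h)).2
    · cases h
  · intro h
    exact Or.inl ⟨w, show w.length < n by omega, collapse_of_lt h⟩

/-- The edges at `u` are the one to its parent and those to its children. -/
lemma wiredTree_isLink_some {u : List (Fin (d - 1))} (hu : u.length + 1 < n)
    {e y : Option (List (Fin (d - 1)))} :
    (wiredTree d n).IsLink e (some u) y ↔
      (e = parentEdge u ∧ y = parent u) ∨
        ∃ i, e = some (i :: u) ∧ y = collapse d n (i :: u) := by
  change ((∃ f, e = some f ∧ Relation.Map ((regularTree d n).IsLink f) (collapse d n)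
    (collapse d n) (some u) y) ∨ (e = none ∧ s(some u, y) = s(collapse d n [], none))) ↔ _
  constructor
  · rintro (⟨f, rfl, x, z, ⟨i, w, rfl, hl, ⟨rfl, rfl⟩ | ⟨rfl, rfl⟩⟩, hx, rfl⟩ | ⟨rfl, h⟩)
    · obtain ⟨rfl, -⟩ := collapse_eq_some.1 hx
      exact Or.inr ⟨i, rfl, rfl⟩
    · obtain ⟨rfl, h⟩ := collapse_eq_some.1 hx
      refine Or.inl ⟨rfl, collapse_of_lt ?_⟩
      simp only [List.length_cons] at h
      omega
    · rw [Sym2.eq_iff] at h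
      rcases h with ⟨h, rfl⟩ | ⟨h, -⟩
      · obtain ⟨rfl, -⟩ := collapse_eq_some.1 h.symm
        exact Or.inl ⟨rfl, rfl⟩
      · cases h
  · rintro (⟨rfl, rfl⟩ | ⟨i, rfl, rfl⟩)
    · cases u with
      | nil => exact Or.inr ⟨rfl, by rw [collapse_of_lt hu]; rfl⟩
      | cons i w =>
        simp only [List.length_cons] at hu
        exact Or.inl ⟨i :: w, rfl, i :: w, w,
          ⟨i, w, rfl, by simp only [List.length_cons]; omega, Or.inr ⟨rfl, rfl⟩⟩,
          collapse_of_lt (by simpa using hu), collapse_of_lt (by omega)⟩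
    · exact Or.inl ⟨i :: u, rfl, u, i :: u,
        ⟨i, u, rfl, by simp only [List.length_cons]; omega, Or.inl ⟨rfl, rfl⟩⟩,
        collapse_of_lt hu, rfl⟩

lemma parent_ne_self {α : Type*} (u : List α) : parent u ≠ some u := by
  cases u with
  | nil => simp [parent]
  | cons i w => exact fun h => List.cons_ne_self i w (Option.some.inj h).symm

lemma parentEdge_ne {α : Type*} (u : List α) (i : α) : parentEdge u ≠ some (i :: u) := by
  cases u with
  | nil => simp [parentEdge]
  | cons j w =>
    intro h
    simpa using congrArg List.length (Option.some.inj h)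

lemma vertexDegree_wiredTree (hd : 1 ≤ d) {u : List (Fin (d - 1))} (hu : u.length + 1 < n) :
    vertexDegree (wiredTree d n) (some u) = d := by
  have key : {e | (wiredTree d n).IsNonloopAt e (some u)} =
      insert (parentEdge u) (Set.range fun i => some (i :: u)) := by
    ext e
    simp only [Graph.IsNonloopAt, wiredTree_isLink_some hu, Set.mem_ofPred_eq, Set.mem_insert_iff,
      Set.mem_range]
    constructor
    · rintro ⟨y, -, ⟨rfl, -⟩ | ⟨i, rfl, -⟩⟩
      · exact Or.inl rfl
      · exact Or.inr ⟨i, rfl⟩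
    · rintro (rfl | ⟨i, rfl⟩)
      · exact ⟨parent u, parent_ne_self u, Or.inl ⟨rfl, rfl⟩⟩
      · refine ⟨_, fun h => ?_, Or.inr ⟨i, rfl, rfl⟩⟩
        exact List.cons_ne_self i u (collapse_eq_some.1 h).1
  have hinj : Function.Injective fun i : Fin (d - 1) => some (i :: u) := by
    intro i j h
    simpa using h
  rw [vertexDegree, key, Set.ncard_insert_of_notMem, ← Set.image_univ,
    Set.ncard_image_of_injective _ hinj, Set.ncard_univ, Nat.card_eq_fintype_card,
    Fintype.card_fin]
  · omega
  · rintro ⟨i, h⟩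
    exact parentEdge_ne u i h.symm

lemma edgeCount_wiredTree {u v : List (Fin (d - 1))} (hu : u.length + 1 < n)
    (hv : v.length + 1 < n) :
    edgeCount (wiredTree d n) (some v) (some u) =
      (∑ i, if v = i :: u then 1 else 0) + if some v = parent u then 1 else 0 := by
  have key : {e | (wiredTree d n).IsLink e (some v) (some u)} =
      {e | (e = parentEdge u ∧ some v = parent u) ∨ ∃ i, e = some v ∧ v = i :: u} := by
    ext e
    rw [Set.mem_ofPred_eq, Graph.isLink_comm, wiredTree_isLink_some hu]
    refine or_congr Iff.rfl (exists_congr fun i => ?_)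
    rw [eq_comm (a := some v), collapse_eq_some]
    constructor
    · rintro ⟨rfl, rfl, -⟩
      exact ⟨rfl, rfl⟩
    · rintro ⟨rfl, rfl⟩
      exact ⟨rfl, rfl, hv⟩
  rw [edgeCount, key]
  by_cases hp : some v = parent u
  · have hne : ∀ i, v ≠ i :: u := by
      rintro i rfl
      cases u with
      | nil => cases hp
      | cons j w =>
        have h := congrArg List.length (Option.some.inj hp)
        simp only [List.length_cons] at h
        omega
    simp [hp, hne]
  · by_cases hc : ∃ i, v = i :: u
    · obtain ⟨i, rfl⟩ := hc
      simp [hp]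
    · simp only [not_exists] at hc
      simp [hp, hc]

instance finite_nonSink_wiredTree : Finite (NonSink (wiredTree d n) none) := by
  have hfin : {x | x ∈ V(wiredTree d n) ∧ x ≠ none}.Finite := by
    refine ((List.finite_length_lt (Fin (d - 1)) n).image some).subset ?_
    rintro (_ | w) ⟨hw, hne⟩
    · exact absurd rfl hne
    · have := some_mem_wiredTree.1 hw
      exact ⟨w, show w.length < n by omega, rfl⟩
  exact hfin.to_subtype

end Graph

/-! ### Generators and relations of the sandpile group -/

section Presentation

variable {d n : ℕ}

lemma exists_eq_some_of_nonSink (x : NonSink (wiredTree d n) none) :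
    ∃ w : List (Fin (d - 1)), w.length + 1 < n ∧ x.1 = some w := by
  obtain ⟨_ | w, hw, hne⟩ := x
  · exact absurd rfl hne
  · exact ⟨w, some_mem_wiredTree.1 hw, rfl⟩

/-- The column of the Laplacian at `u` records the toppling of `u`: one chip to each neighbour,
`d` chips taken from `u`. Chips that arrive at the sink vanish, since `singleChip` is zero there. -/
lemma reducedLaplacian_col_wiredTree (hd : 1 ≤ d) {u : List (Fin (d - 1))}
    (hu : u.length + 1 < n) (x : NonSink (wiredTree d n) none) (hx : x.1 = some u) :
    (reducedLaplacian (wiredTree d n) none).col x =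
      (∑ i, singleChip (wiredTree d n) none (some (i :: u))) +
        singleChip (wiredTree d n) none (parent u) -
          (d : ℤ) • singleChip (wiredTree d n) none (some u) := by
  classical
  ext y
  obtain ⟨v, hv, hy⟩ := exists_eq_some_of_nonSink y
  have hyx : y = x ↔ v = u := by rw [Subtype.ext_iff, hx, hy, Option.some_inj]
  simp only [Matrix.col_apply, reducedLaplacian, Matrix.of_apply, Pi.sub_apply, Pi.add_apply,
    Finset.sum_apply, Pi.smul_apply, singleChip, hy, hyx, hx, Option.some_inj]
  split_ifs with h h' h'
  · exact absurd (h ▸ h'.symm) (parent_ne_self u)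
  · subst h
    simp [vertexDegree_wiredTree hd hu]
  · rw [edgeCount_wiredTree hu hv]
    simp [h']
  · rw [edgeCount_wiredTree hu hv]
    simp [h']

/-- The class in `SP d n` of a single chip at `w`. It vanishes if `w` is too long to be a vertex
other than the sink. -/
noncomputable def chip (d n : ℕ) (w : List (Fin (d - 1))) : SP d n :=
  chipClass (wiredTree d n) none (some w)

lemma singleChip_none : singleChip (wiredTree d n) none none = 0 := by
  ext y
  exact if_neg y.2.2

lemma chip_of_le {w : List (Fin (d - 1))} (h : n ≤ w.length + 1) : chip d n w = 0 := by
  have : singleChip (wiredTree d n) none (some w) = 0 := by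
    ext y
    refine if_neg fun hy => ?_
    have := some_mem_wiredTree.1 (hy ▸ y.2.1)
    omega
  rw [chip, chipClass, this, Submodule.Quotient.mk_zero]

lemma rootElement_eq_chip (d n : ℕ) : rootElement d n = chip d n [] := by
  unfold rootElement
  by_cases h : 1 < n
  · rw [collapse_of_lt (by simpa using h)]
    rfl
  · rw [chip_of_le (by simpa using h), collapse, if_neg (by simpa using h), chipClass,
      singleChip_none, Submodule.Quotient.mk_zero]

/-- The extension by zero to the sink of the value at the parent. -/
def atParent {α A : Type*} [Zero A] (F : List α → A) (w : List α) : A :=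
  (parent w).elim 0 F

@[simp] lemma atParent_nil {α A : Type*} [Zero A] (F : List α → A) : atParent F [] = 0 := rfl

@[simp] lemma atParent_cons {α A : Type*} [Zero A] (F : List α → A) (i : α) (w : List α) :
    atParent F (i :: w) = F w := rfl

/-- The function `F` on words vanishes at and below the leaves of the tree of height `n`, and it is
harmonic at the other vertices of the wired tree, the value at the sink being zero. -/
structure IsHarmonic {A : Type*} [AddCommGroup A] (d n : ℕ) (F : List (Fin (d - 1)) → A) :
    Prop where
  eq_zero : ∀ w, n ≤ w.length + 1 → F w = 0
  sum_add : ∀ w, w.length + 1 < n → (∑ i, F (i :: w)) + atParent F w = d • F w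

lemma isHarmonic_chip (hd : 1 ≤ d) (n : ℕ) : IsHarmonic d n (chip d n) where
  eq_zero _ h := chip_of_le h
  sum_add u hu := by
    have hx : some u ∈ V(wiredTree d n) ∧ some u ≠ none :=
      ⟨some_mem_wiredTree.2 hu, Option.some_ne_none u⟩
    have hmem : (reducedLaplacian (wiredTree d n) none).col ⟨some u, hx⟩ ∈
        laplacianLattice (wiredTree d n) none := Submodule.subset_span ⟨_, rfl⟩
    rw [reducedLaplacian_col_wiredTree hd hu ⟨some u, hx⟩ rfl,
      ← Submodule.Quotient.mk_eq_zero] at hmem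
    have hp : Submodule.Quotient.mk (singleChip (wiredTree d n) none (parent u)) =
        atParent (chip d n) u := by
      cases u with
      | nil => exact (congrArg _ singleChip_none).trans (Submodule.Quotient.mk_zero _)
      | cons i w => rfl
    rw [Submodule.Quotient.mk_sub, Submodule.Quotient.mk_add, hp, ← Submodule.mkQ_apply,
      map_sum, Submodule.Quotient.mk_smul, sub_eq_zero, natCast_zsmul] at hmem
    exact hmem

/-- Homomorphisms out of the sandpile group are determined by their values on chips. -/
lemma SP_hom_ext {A : Type*} [AddCommGroup A] {f g : SP d n →+ A}
    (h : ∀ w, w.length + 1 < n → f (chip d n w) = g (chip d n w)) : f = g := by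
  classical
  have : Fintype (NonSink (wiredTree d n) none) := Fintype.ofFinite _
  have hfg : f.toIntLinearMap = g.toIntLinearMap := by
    refine Submodule.linearMap_qext _ (LinearMap.pi_ext' fun x => LinearMap.ext_ring ?_)
    obtain ⟨w, hw, hx⟩ := exists_eq_some_of_nonSink x
    have hs : Pi.single x 1 = singleChip (wiredTree d n) none (some w) := by
      ext y
      simp only [Pi.single_apply, singleChip, Subtype.ext_iff, hx]
      congr
    change f (Submodule.Quotient.mk (Pi.single x 1)) = g (Submodule.Quotient.mk (Pi.single x 1))
    rw [hs]
    exact h w hw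
  ext x
  exact DFunLike.congr_fun hfg x

/-- A harmonic function extends to a homomorphism on the sandpile group. -/
lemma IsHarmonic.exists_hom {A : Type*} [AddCommGroup A] (hd : 1 ≤ d)
    {F : List (Fin (d - 1)) → A} (hF : IsHarmonic d n F) :
    ∃ f : SP d n →+ A, ∀ w, f (chip d n w) = F w := by
  classical
  have : Fintype (NonSink (wiredTree d n) none) := Fintype.ofFinite _
  let L : (NonSink (wiredTree d n) none → ℤ) →ₗ[ℤ] A :=
    Fintype.linearCombination ℤ fun x => x.1.elim 0 F
  have hL : ∀ w, L (singleChip (wiredTree d n) none (some w)) = F w := by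
    intro w
    rw [Fintype.linearCombination_apply]
    by_cases hw : w.length + 1 < n
    · rw [Finset.sum_eq_single_of_mem
        ⟨some w, some_mem_wiredTree.2 hw, Option.some_ne_none w⟩ (Finset.mem_univ _)]
      · simp [singleChip]
      · intro y _ hy
        have : y.1 ≠ some w := fun h => hy (Subtype.ext h)
        simp [singleChip, this]
    · rw [hF.eq_zero w (by omega)]
      refine Finset.sum_eq_zero fun y _ => ?_
      have : y.1 ≠ some w := fun h => hw (some_mem_wiredTree.1 (h ▸ y.2.1))
      simp [singleChip, this]
  have hker : laplacianLattice (wiredTree d n) none ≤ LinearMap.ker L := by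
    refine Submodule.span_le.2 ?_
    rintro _ ⟨x, rfl⟩
    obtain ⟨u, hu, hx⟩ := exists_eq_some_of_nonSink x
    have hp : L (singleChip (wiredTree d n) none (parent u)) = atParent F u := by
      cases u with
      | nil => exact (congrArg L singleChip_none).trans (map_zero L)
      | cons i w => exact hL w
    rw [SetLike.mem_coe, LinearMap.mem_ker, reducedLaplacian_col_wiredTree hd hu x hx, map_sub,
      map_add, map_sum, map_smul, hp, hL, sub_eq_zero, natCast_zsmul, ← hF.sum_add u hu]
    simp only [hL]
  exact ⟨((laplacianLattice (wiredTree d n) none).liftQ L hker).toAddMonoidHom, hL⟩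

end Presentation

/-! ### The root subgroup is a direct summand -/

section Splitting

variable {d n : ℕ}

/-- Induction from the leaves upwards relates the class at each vertex to that at its parent: with
`q k = 1 + (d - 1) + ⋯ + (d - 1) ^ (k - 1)`, a chip at height `h` above the leaves has
`q (h + 1) • chip = q h • (chip at the parent)`. -/
lemma geom_sum_nsmul_chip (hd : 1 ≤ d) (h : ℕ) :
    ∀ w : List (Fin (d - 1)), w.length + h + 1 = n →
      (∑ j ∈ Finset.range (h + 1), (d - 1) ^ j) • chip d n w =
        (∑ j ∈ Finset.range h, (d - 1) ^ j) • atParent (chip d n) w := by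
  induction h with
  | zero =>
    intro w hw
    simp [chip_of_le (show n ≤ w.length + 1 by omega)]
  | succ h ih =>
    intro w hw
    have hrel := (isHarmonic_chip hd n).sum_add w (by omega)
    have hchild : ∀ i, (∑ j ∈ Finset.range (h + 1), (d - 1) ^ j) • chip d n (i :: w) =
        (∑ j ∈ Finset.range h, (d - 1) ^ j) • chip d n w := fun i => by
      simpa using ih (i :: w) (by simp only [List.length_cons]; omega)
    have hsum := congrArg ((∑ j ∈ Finset.range (h + 1), (d - 1) ^ j) • ·) hrel
    simp only [smul_add, Finset.smul_sum, hchild, Finset.sum_const, Finset.card_univ,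
      Fintype.card_fin, smul_smul] at hsum
    have hnum : (∑ j ∈ Finset.range (h + 1), (d - 1) ^ j) * d =
        (d - 1) * (∑ j ∈ Finset.range h, (d - 1) ^ j) +
          ∑ j ∈ Finset.range (h + 1 + 1), (d - 1) ^ j := by
      obtain ⟨a, rfl⟩ : ∃ a, d = a + 1 := ⟨d - 1, by omega⟩
      have h1 := geom_sum_succ (x := a) (n := h)
      have h2 := geom_sum_succ (x := a) (n := h + 1)
      simp only [Nat.add_sub_cancel]
      rw [h2]
      nlinarith
    rw [hnum, add_smul] at hsum
    exact (add_left_cancel hsum).symm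

lemma geom_sum_nsmul_rootElement (hd : 1 ≤ d) (hn : 1 ≤ n) :
    (∑ j ∈ Finset.range n, (d - 1) ^ j) • rootElement d n = 0 := by
  obtain ⟨h, rfl⟩ : ∃ h, n = h + 1 := ⟨n - 1, by omega⟩
  rw [rootElement_eq_chip, geom_sum_nsmul_chip hd h [] (by simp), atParent_nil, smul_zero]

/-- Modulo `q = 1 + a + ⋯ + a ^ (n - 1)`, where `a = d - 1` is a unit, the function
`w ↦ 1 + a⁻¹ + ⋯ + a ^ (-|w|)` of the level is harmonic. -/
lemma exists_hom_zmod (hd : 1 ≤ d) (hn : 2 ≤ n) :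
    ∃ f : SP d n →+ ZMod (∑ j ∈ Finset.range n, (d - 1) ^ j), f (rootElement d n) = 1 := by
  set q := ∑ j ∈ Finset.range n, (d - 1) ^ j with hq
  set a : ZMod q := ((d - 1 : ℕ) : ZMod q) with ha
  have hd' : (d : ZMod q) = a + 1 := by
    rw [ha, ← Nat.cast_succ]
    congr 1
    omega
  have hsum : ∑ j ∈ Finset.range n, a ^ j = 0 := by
    have := ZMod.natCast_self q
    rw [hq] at this
    push_cast at this
    exact this
  have hpow : a ^ n = 1 := by
    have := geom_sum_mul a n
    rw [hsum, zero_mul] at this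
    exact (sub_eq_zero.1 this.symm)
  obtain ⟨b, hab⟩ : ∃ b : ZMod q, a * b = 1 :=
    ⟨a ^ (n - 1), by rw [← pow_succ', Nat.sub_add_cancel (by omega), hpow]⟩
  let g : ℕ → ZMod q := fun k => ∑ j ∈ Finset.range (k + 1), b ^ j
  have hg : ∀ k, g (k + 1) = g k + b ^ (k + 1) := fun k => Finset.sum_range_succ _ _
  have hleaf : g (n - 1) = 0 := by
    -- Reversing the order of summation turns powers of `b` into powers of `a`.
    have hrefl : ∑ j ∈ Finset.range n, b ^ j = b ^ (n - 1) * ∑ j ∈ Finset.range n, a ^ j := by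
      rw [← Finset.sum_range_reflect, Finset.mul_sum]
      refine Finset.sum_congr rfl fun j hj => ?_
      have hj' : n - 1 = (n - 1 - j) + j := by
        have := Finset.mem_range.1 hj
        omega
      conv_rhs => rw [hj', pow_add, mul_assoc, ← mul_pow, mul_comm b a, hab, one_pow, mul_one]
    change ∑ j ∈ Finset.range (n - 1 + 1), b ^ j = 0
    rw [Nat.sub_add_cancel (by omega), hrefl, hsum, mul_zero]
  let F : List (Fin (d - 1)) → ZMod q := fun w => if w.length + 1 < n then g w.length else 0
  have hF : ∀ w, w.length < n → F w = g w.length := by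
    intro w hw
    by_cases h : w.length + 1 < n
    · exact if_pos h
    · rw [show w.length = n - 1 by omega, hleaf]
      exact if_neg h
  have hharm : IsHarmonic d n F := by
    refine ⟨fun w hw => if_neg (by omega), fun w hw => ?_⟩
    have hchild : ∀ i, F (i :: w) = g (w.length + 1) := fun i => by
      rw [hF (i :: w) (by simpa using hw), List.length_cons]
    simp only [hchild, Finset.sum_const, Finset.card_univ, Fintype.card_fin, nsmul_eq_mul,
      hF w (by omega), hd', ← ha, hg]
    cases w with
    | nil =>
      have h0 : g 0 = 1 := by simp [g]
      simp only [atParent_nil, List.length_nil, h0]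
      linear_combination hab
    | cons i w =>
      simp only [List.length_cons] at hw
      simp only [atParent_cons, List.length_cons, hF w (by omega), hg]
      linear_combination b ^ (w.length + 1) * hab
  obtain ⟨f, hf⟩ := hharm.exists_hom hd
  refine ⟨f, ?_⟩
  rw [rootElement_eq_chip, hf, hF [] (by simp; omega)]
  simp [g]

/-- A homomorphism `f` to `ZMod q` with `f r = 1`, where `q • r = 0`, splits off the subgroup
generated by `r`. -/
lemma isCompl_zmultiples_ker {A : Type*} [AddCommGroup A] {q : ℕ} {r : A} (hr : q • r = 0)
    (f : A →+ ZMod q) (hf : f r = 1) : IsCompl (AddSubgroup.zmultiples r) f.ker := by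
  refine IsCompl.of_le (fun x hx => ?_) fun x _ => ?_
  · obtain ⟨⟨k, rfl⟩, hk⟩ := hx
    have hk' : f (k • r) = 0 := hk
    rw [map_zsmul, hf, zsmul_eq_mul, mul_one, ZMod.intCast_zmod_eq_zero_iff_dvd] at hk'
    obtain ⟨m, rfl⟩ := hk'
    change ((q : ℤ) * m) • r = 0
    rw [mul_comm, mul_zsmul, natCast_zsmul, hr, zsmul_zero]
  · obtain ⟨k, hk⟩ := ZMod.intCast_surjective (f x)
    refine AddSubgroup.mem_sup.2 ⟨k • r, ⟨k, rfl⟩, x - k • r, ?_, add_sub_cancel _ _⟩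
    rw [AddMonoidHom.mem_ker, map_sub, map_zsmul, hf, ← hk]
    simp

/-- A direct summand splits off the corresponding quotient. -/
lemma nonempty_addEquiv_prod_quotient {A : Type*} [AddCommGroup A] {H C : AddSubgroup A}
    (h : IsCompl H C) : Nonempty (A ≃+ H × (A ⧸ H)) := by
  have h' : IsCompl (AddSubgroup.toIntSubmodule H) (AddSubgroup.toIntSubmodule C) :=
    (AddSubgroup.toIntSubmodule (M := A)).isCompl h
  exact ⟨((((LinearEquiv.refl ℤ _).prodCongr
    (Submodule.quotientEquivOfIsCompl _ _ h')).trans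
      (Submodule.prodEquivOfIsCompl _ _ h')).symm).toAddEquiv⟩

end Splitting

/-! ### The quotient by the root subgroup -/

section Quotient

variable {d n : ℕ}

/-- The class of `Pi.single i (chip w)` attached to the word `w ++ [i]`, that is, to the vertex `w`
of the `i`-th principal branch; the root gets zero. -/
noncomputable def branchChip (d n : ℕ) (w : List (Fin (d - 1))) :
    (Fin (d - 1) → SP d n) ⧸ diagonalRootSubgroup d n :=
  if h : w = [] then 0 else
    QuotientAddGroup.mk (Pi.single (w.getLast h) (chip d n w.dropLast))

@[simp] lemma branchChip_nil : branchChip d n [] = 0 := dif_pos rfl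

@[simp] lemma branchChip_append (w : List (Fin (d - 1))) (i : Fin (d - 1)) :
    branchChip d n (w ++ [i]) = QuotientAddGroup.mk (Pi.single i (chip d n w)) := by
  simp [branchChip]

lemma const_rootElement_mem : (fun _ => rootElement d n) ∈ diagonalRootSubgroup d n :=
  ⟨rootElement d n, AddSubgroup.mem_zmultiples _, rfl⟩

lemma isHarmonic_branchChip (hd : 1 ≤ d) (n : ℕ) :
    IsHarmonic d (n + 1) (branchChip d n) where
  eq_zero w hw := by
    rcases List.eq_nil_or_concat w with rfl | ⟨u, i, rfl⟩
    · exact branchChip_nil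
    · rw [List.concat_eq_append] at hw ⊢
      rw [branchChip_append, chip_of_le (by simp at hw; omega), Pi.single_zero,
        QuotientAddGroup.mk_zero]
  sum_add w hw := by
    rcases List.eq_nil_or_concat w with rfl | ⟨u, j, rfl⟩
    · have h1 : ∀ i : Fin (d - 1), branchChip d n [i] =
          QuotientAddGroup.mk' (diagonalRootSubgroup d n) (Pi.single i (chip d n [])) :=
        fun i => branchChip_append [] i
      simp only [h1, atParent_nil, branchChip_nil, smul_zero, add_zero]
      rw [← map_sum, Finset.univ_sum_single fun _ => chip d n []]
      refine (QuotientAddGroup.eq_zero_iff _).2 ?_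
      rw [← rootElement_eq_chip]
      exact const_rootElement_mem
    · rw [List.concat_eq_append] at hw ⊢
      let φ : SP d n →+ (Fin (d - 1) → SP d n) ⧸ diagonalRootSubgroup d n :=
        (QuotientAddGroup.mk' _).comp (AddMonoidHom.single (fun _ => SP d n) j)
      have hφ : ∀ v, branchChip d n (v ++ [j]) = φ (chip d n v) := fun v =>
        branchChip_append v j
      have hp : atParent (branchChip d n) (u ++ [j]) = φ (atParent (chip d n) u) := by
        cases u with
        | nil => simp
        | cons i v => exact hφ v
      have hrel := (isHarmonic_chip hd n).sum_add u (by simpa using hw)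
      simp only [← List.cons_append, hφ, hp]
      rw [← map_sum, ← map_add, hrel, map_nsmul]

lemma isHarmonic_mk_chip_append (hd : 1 ≤ d) (n : ℕ) (i : Fin (d - 1)) :
    IsHarmonic d n fun w =>
      QuotientAddGroup.mk' (rootSubgroup d (n + 1)) (chip d (n + 1) (w ++ [i])) where
  eq_zero w hw := by
    rw [chip_of_le (by simpa using hw), map_zero]
  sum_add w hw := by
    have hrel := (isHarmonic_chip hd (n + 1)).sum_add (w ++ [i]) (by simpa using hw)
    rw [← map_nsmul, ← hrel, map_add, map_sum]
    congr 1
    cases w with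
    | nil =>
      refine Eq.symm ((QuotientAddGroup.eq_zero_iff _).2 ?_)
      change chip d (n + 1) [] ∈ _
      rw [← rootElement_eq_chip]
      exact AddSubgroup.mem_zmultiples _
    | cons j v => rfl

/-- Deleting the root cuts the wired tree into wired trees of smaller height, whose sinks are
identified; toppling the root gives the relation that the sum of their roots vanishes. -/
lemma nonempty_quotient_rootSubgroup_addEquiv (hd : 1 ≤ d) (hn : 1 ≤ n) :
    Nonempty ((SP d (n + 1) ⧸ rootSubgroup d (n + 1)) ≃+
      ((Fin (d - 1) → SP d n) ⧸ diagonalRootSubgroup d n)) := by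
  classical
  obtain ⟨f, hf⟩ := (isHarmonic_branchChip hd n).exists_hom hd
  choose g hg using fun i => (isHarmonic_mk_chip_append hd n i).exists_hom hd
  let G : (Fin (d - 1) → SP d n) →+ SP d (n + 1) ⧸ rootSubgroup d (n + 1) :=
    ∑ i, (g i).comp (Pi.evalAddMonoidHom (fun _ => SP d n) i)
  have hG : ∀ i x, G (Pi.single i x) = g i x := by
    intro i x
    simp only [G, AddMonoidHom.finsetSum_apply, AddMonoidHom.comp_apply, Pi.evalAddMonoidHom_apply]
    rw [Finset.sum_eq_single_of_mem i (Finset.mem_univ _), Pi.single_eq_same]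
    intro j _ hj
    rw [Pi.single_eq_of_ne hj, map_zero]
  have hf0 : rootSubgroup d (n + 1) ≤ f.ker := by
    refine AddSubgroup.zmultiples_le.2 ?_
    rw [AddMonoidHom.mem_ker, rootElement_eq_chip, hf, branchChip_nil]
  have hG0 : diagonalRootSubgroup d n ≤ G.ker := by
    rw [diagonalRootSubgroup, AddSubgroup.map_le_iff_le_comap, rootSubgroup,
      AddSubgroup.zmultiples_le, AddSubgroup.mem_comap, AddMonoidHom.mem_ker,
      rootElement_eq_chip]
    have hrel := (isHarmonic_chip hd (n + 1)).sum_add [] (by simp; omega)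
    rw [atParent_nil, add_zero] at hrel
    have : G (fun _ => chip d n []) = ∑ i, QuotientAddGroup.mk' (rootSubgroup d (n + 1))
        (chip d (n + 1) [i]) := by
      simp only [G, AddMonoidHom.finsetSum_apply, AddMonoidHom.comp_apply,
        Pi.evalAddMonoidHom_apply, hg, List.nil_append]
    refine this.trans ?_
    rw [← map_sum, hrel, map_nsmul]
    convert smul_zero d
    refine (QuotientAddGroup.eq_zero_iff _).2 ?_
    rw [← rootElement_eq_chip]
    exact AddSubgroup.mem_zmultiples _
  let f' := QuotientAddGroup.lift _ f hf0
  let G' := QuotientAddGroup.lift _ G hG0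
  refine ⟨AddMonoidHom.toAddEquiv f' G' ?_ ?_⟩
  · refine QuotientAddGroup.addMonoidHom_ext _ (SP_hom_ext fun w _ => ?_)
    change G' (f (chip d (n + 1) w)) = QuotientAddGroup.mk' (rootSubgroup d (n + 1)) _
    rw [hf]
    rcases List.eq_nil_or_concat w with rfl | ⟨u, i, rfl⟩
    · rw [branchChip_nil, map_zero]
      refine Eq.symm ((QuotientAddGroup.eq_zero_iff _).2 ?_)
      rw [← rootElement_eq_chip]
      exact AddSubgroup.mem_zmultiples _
    · rw [List.concat_eq_append, branchChip_append]
      exact (hG i _).trans (hg i u)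
  · refine QuotientAddGroup.addMonoidHom_ext _ (AddMonoidHom.functions_ext' _ _ _ fun i =>
      SP_hom_ext fun w _ => ?_)
    change f' (G (Pi.single i (chip d n w))) = QuotientAddGroup.mk (Pi.single i (chip d n w))
    rw [hG, hg]
    exact (hf _).trans (branchChip_append w i)

end Quotient

end Sandpile

theorem proposition4p3 (d n : ℕ) (hd : 3 ≤ d) (hn : 2 ≤ n) :
    (∃ C : AddSubgroup (Sandpile.SP d n), IsCompl (Sandpile.rootSubgroup d n) C) ∧
    Nonempty (Sandpile.SP d n ≃+
      Sandpile.rootSubgroup d n ×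
        ((Fin (d - 1) → Sandpile.SP d (n - 1)) ⧸ Sandpile.diagonalRootSubgroup d (n - 1))) := by
  obtain ⟨f, hf⟩ := Sandpile.exists_hom_zmod (d := d) (by omega) hn
  have hC : IsCompl (Sandpile.rootSubgroup d n) f.ker :=
    Sandpile.isCompl_zmultiples_ker
      (Sandpile.geom_sum_nsmul_rootElement (by omega) (by omega)) f hf
  refine ⟨⟨f.ker, hC⟩, ?_⟩
  obtain ⟨e⟩ := Sandpile.nonempty_addEquiv_prod_quotient hC
  obtain ⟨m, rfl⟩ : ∃ m, n = m + 1 := ⟨n - 1, by omega⟩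
  obtain ⟨e'⟩ := Sandpile.nonempty_quotient_rootSubgroup_addEquiv (d := d) (n := m)
    (by omega) (by omega)
  exact ⟨e.trans ((AddEquiv.refl _).prodCongr e')⟩
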